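/- Let $q$ be a power of $2$, $\mathbb{F}_q$ a field with $q$ elements, $A=\mathbb{F}_q[t]$, and $K_\infty=\mathbb{F}_q((1/t))$ the completion of $\mathbb{F}_q(t)$ at its infinite place. For positive integers $s_1,\dots,s_r$ let $$\zeta(s_1,\dots,s_r)=\sum \frac{1}{a_1^{s_1}\cdots a_r^{s_r}}\in K_\infty,$$ the sum being over all monic $a_1,\dots,a_r\in A$ with $\deg a_1>\cdots>\deg a_r\ge 0$ (Thakur's multizeta value; for $r=1$ this is the Carlitz zeta value). Put $r_2=(q-1)2^m$, where $m$ is the smallest integer with $2\le 2^m$, so that $r_2=2(q-1)$, and $\phi(i,j)=r_2-2-j(q-1)+ir_2$. For $x\in\mathbb{Q}$ let $[x\in\mathbb{Z}]$ be $1$ if $x$ is an integer and $0$ otherwise. Let $b$ be a positive integer and write $b=r_2\sigma+\beta$ with integers $\sigma\ge 0$ and $0<\beta\le r_2$. Then $$\zeta(2)\zeta(b)=\zeta(2+b)+\zeta(2,b)+\zeta(b,2)+\sum_{i=0}^{\sigma-1}\zeta\bigl(b-\phi(i,0),\,2+\phi(i,0)\bigr)+\Bigl[\tfrac{b}{q-1}\in\mathbb{Z}\Bigr]\tfrac{b}{q-1}\,\zeta(2,b),$$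 where an integer coefficient is read in $\mathbb{F}_2\subset K_\infty$. -/

import Mathlib

open Polynomial

/-- The canonical embedding of the polynomial ring `A = F[t]` in `K_∞ = F((1/t))`, the completion
of the rational function field `K = F(t)` at its place at infinity. -/
noncomputable def polyToKInfty (F : Type*) [Field F] [DecidableEq (RatFunc F)] (a : F[X]) :
    RatFunc.CompletionAtInfty F :=
  algebraMap (RatFunc F) (RatFunc.CompletionAtInfty F) (algebraMap F[X] (RatFunc F) a)

/-- The tuples `(a_1, …, a_r)` of monic polynomials with `deg a_1 > ⋯ > deg a_r ≥ 0`. -/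
def DecreasingMonicTuple (F : Type*) [Field F] (r : ℕ) : Type _ :=
  {a : Fin r → F[X] // (∀ i, (a i).Monic) ∧ StrictAnti fun i => (a i).natDegree}

/-- Thakur's multizeta value `ζ(s_1, …, s_r) = ∑ 1 / (a_1 ^ s_1 ⋯ a_r ^ s_r) ∈ K_∞`, the sum being
over all monic `a_1, …, a_r ∈ F[t]` with `deg a_1 > ⋯ > deg a_r ≥ 0`. It is used for positive
integers `s_i`, where the series converges unconditionally (`summable_multizeta`). In depth one it
is the Carlitz zeta value `ζ(s) = ∑ 1 / a ^ s`, the sum over all monic `a`. -/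
noncomputable def multizeta (F : Type*) [Field F] [DecidableEq (RatFunc F)] {r : ℕ}
    (s : Fin r → ℤ) : RatFunc.CompletionAtInfty F :=
  ∑' a : DecreasingMonicTuple F r, 1 / ∏ i, polyToKInfty F (a.1 i) ^ s i

/-- `r_a = (q - 1) p ^ m`, where `m` is the smallest integer with `a ≤ p ^ m`
(for a positive integer `a`, a prime `p` and a power `q` of `p`). -/
def rParam (p q a : ℕ) : ℕ := (q - 1) * p ^ Nat.clog p a

/-- `φ(i, j) = r_a - a - j (q - 1) + i r_a`. -/
def phiParam (p q a : ℕ) (i j : ℤ) : ℤ :=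
  (rParam p q a : ℤ) - a - j * ((q : ℤ) - 1) + i * rParam p q a

instance instCompleteSpaceCompletionAtInfty (F : Type*) [Field F] [DecidableEq (RatFunc F)] :
    CompleteSpace (RatFunc.CompletionAtInfty F) := by
  let : UniformSpace (RatFunc F) := (RatFunc.inftyValued F).toUniformSpace
  exact inferInstanceAs (CompleteSpace (UniformSpace.Completion (RatFunc F)))

instance instNonarchimedeanRingCompletionAtInfty (F : Type*) [Field F]
    [DecidableEq (RatFunc F)] : NonarchimedeanRing (RatFunc.CompletionAtInfty F) := by
  have h := (Valued.v (R := RatFunc.CompletionAtInfty F)).subgroups_basis.nonarchimedean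
  have e : (Valued.v (R := RatFunc.CompletionAtInfty F)).subgroups_basis.topology =
      (inferInstance : TopologicalSpace (RatFunc.CompletionAtInfty F)) := by
    rw [Valued.toUniformSpace_eq (RatFunc.CompletionAtInfty F) (WithZero (Multiplicative ℤ))]
    rfl
  rwa [e] at h

theorem valued_polyToKInfty (F : Type*) [Field F] [DecidableEq (RatFunc F)] (a : F[X])
    (ha : a ≠ 0) :
    Valued.v (polyToKInfty F a) = WithZero.exp (a.natDegree : ℤ) := by
  rw [← RatFunc.inftyValuation.polynomial F ha, RatFunc.valuedCompletionAtInfty.def]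
  let := RatFunc.inftyValued F
  exact Valued.extensionValuation_apply_coe (algebraMap F[X] (RatFunc F) a)

theorem finite_decreasingMonicTuple_natDegree_le (F : Type*) [Field F] [Finite F] (r N : ℕ) :
    {a : DecreasingMonicTuple F r | ∀ i, (a.1 i).natDegree ≤ N}.Finite := by
  have hfin : Finite (degreeLT F (N + 1)) :=
    Finite.of_equiv _ (degreeLTEquiv F (N + 1)).toEquiv.symm
  have h1 : ((degreeLT F (N + 1) : Set F[X])).Finite := hfin
  have h2 := Set.Finite.pi (fun _ : Fin r => h1)
  refine (h2.preimage (f := fun a : DecreasingMonicTuple F r => a.1)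
    Subtype.val_injective.injOn).subset ?_
  intro a ha
  simp only [Set.mem_preimage, Set.mem_univ_pi, SetLike.mem_coe, mem_degreeLT]
  intro i
  exact lt_of_le_of_lt degree_le_natDegree (by exact_mod_cast Nat.lt_succ_of_le (ha i))

theorem summable_multizeta (F : Type*) [Field F] [Finite F] [DecidableEq (RatFunc F)] {r : ℕ}
    (s : Fin r → ℤ) (hs : ∀ i, 0 < s i) :
    Summable fun a : DecreasingMonicTuple F r => 1 / ∏ i, polyToKInfty F (a.1 i) ^ s i := by
  have hv : ∀ a : DecreasingMonicTuple F r,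
      Valued.v (1 / ∏ i, polyToKInfty F (a.1 i) ^ s i)
        = WithZero.exp (-∑ i, s i * ((a.1 i).natDegree : ℤ)) := by
    intro a
    have hexp : ∀ (t : Finset (Fin r)) (f : Fin r → ℤ),
        WithZero.exp (∑ i ∈ t, f i) = ∏ i ∈ t, WithZero.exp (f i) := by
      intro t f
      induction t using Finset.cons_induction with
      | empty => simp
      | cons i t hi ih => rw [Finset.sum_cons, Finset.prod_cons, WithZero.exp_add, ih]
    rw [one_div, map_inv₀, map_prod, WithZero.exp_neg, hexp]
    congr 1
    refine Finset.prod_congr rfl fun i _ => ?_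
    rw [map_zpow₀, valued_polyToKInfty F _ (a.2.1 i).ne_zero, ← WithZero.exp_zsmul, smul_eq_mul]
  refine NonarchimedeanAddGroup.summable_of_tendsto_cofinite_zero ?_
  rw [(Valued.hasBasis_nhds_zero _ _).tendsto_right_iff]
  intro γ _
  obtain ⟨n, hn⟩ : ∃ n : ℤ, MonoidWithZeroHom.ValueGroup₀.embedding γ.1 = WithZero.exp n :=
    ⟨_, (WithZero.exp_log (by simp)).symm⟩
  rw [Filter.eventually_cofinite]
  refine (finite_decreasingMonicTuple_natDegree_le F r (-n).toNat).subset ?_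
  intro a ha i
  simp only [Set.mem_ofPred_eq, Valuation.restrict_lt_iff_lt_embedding, hn, hv,
    WithZero.exp_lt_exp, not_lt] at ha
  have h1 : s i * ((a.1 i).natDegree : ℤ) ≤ ∑ i, s i * ((a.1 i).natDegree : ℤ) :=
    Finset.single_le_sum (f := fun i => s i * ((a.1 i).natDegree : ℤ))
      (fun j _ => mul_nonneg (hs j).le (by positivity)) (Finset.mem_univ i)
  have h2 : ((a.1 i).natDegree : ℤ) ≤ s i * ((a.1 i).natDegree : ℤ) :=
    le_mul_of_one_le_left (by positivity) (hs i)
  omega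

/-! Expand `ζ(2) ζ(b)` over pairs `(x, y)` of monic polynomials. Unequal degrees give `ζ(2, b)` and
`ζ(b, 2)`; `x = y` gives `ζ(2 + b)`. Otherwise `x = y + f c` with `f` a unit and `c` monic of
smaller degree, so `x + y = f c` in characteristic 2. Partial fractions in `x + y`
(`inv_sq_mul_inv_pow_eq_sum`) split the summand into products of a power of `1 / y` or `1 / x` with
a power of `1 / (f c)`; summing `f⁻ˡ` over units keeps only the `l` divisible by `q - 1`. This is
`multizeta_two_mul_multizeta`.

Its coefficients `k + 1` matter only mod 2. As `q - 1` is odd, the surviving exponents `k + 2` are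
the multiples of `r_2 = 2 (q - 1)`, and `sum_add_boundary_eq` matches what happens near the end of
the sum with the term in `b / (q - 1)`. -/

section PartialFractions

/-- The partial fraction decomposition of `1 / (x ^ 2 * y ^ b)` with respect to `x + y`. -/
theorem inv_sq_mul_inv_pow_eq_sum {K : Type*} [Field K] {x y : K} (hx : x ≠ 0) (hy : y ≠ 0)
    (hxy : x + y ≠ 0) (b : ℕ) :
    (x ^ 2)⁻¹ * (y ^ (b + 1))⁻¹ =
      ∑ k ∈ Finset.range (b + 1), ((k + 1 : ℕ) : K) *
          ((y ^ (b + 1 - k))⁻¹ * ((x + y) ^ (k + 2))⁻¹)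
        + (x ^ 2)⁻¹ * ((x + y) ^ (b + 1))⁻¹
        + ((b + 1 : ℕ) : K) * ((x ^ 1)⁻¹ * ((x + y) ^ (b + 2))⁻¹) := by
  induction b with
  | zero =>
    simp
    field_simp
    ring
  | succ b ih =>
    have key : ∀ k ∈ Finset.range (b + 1), ((k + 1 : ℕ) : K) *
          ((y ^ (b + 1 + 1 - k))⁻¹ * ((x + y) ^ (k + 2))⁻¹) = ((k + 1 : ℕ) : K) *
          ((y ^ (b + 1 - k))⁻¹ * ((x + y) ^ (k + 2))⁻¹) * y⁻¹ := by
      intro k hk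
      rw [show b + 1 + 1 - k = (b + 1 - k) + 1 by grind, pow_succ y, mul_inv]
      ring
    -- Multiplying by `1 / y` carries the old sum into the new one; the two `x`-terms must then
    -- produce the summand `k = b + 1` and the new `x`-terms.
    rw [pow_succ y (b + 1), mul_inv, ← mul_assoc, ih, Finset.sum_range_succ _ (b + 1),
      Finset.sum_congr rfl key, ← Finset.sum_mul, show b + 1 + 1 - (b + 1) = 1 by omega,
      add_mul, add_mul, add_assoc, add_assoc, add_assoc]
    congr 1
    push_cast
    generalize hz : x + y = z at hxy
    have hyz : y = z - x := by rw [← hz]; ring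
    have hzx : z - x ≠ 0 := hyz ▸ hy
    subst hyz
    field_simp
    ring

end PartialFractions

/-- Summing over the positive multiples of `r` up to `n`. -/
theorem sum_range_ite_dvd {M : Type*} [AddCommMonoid M] (r : ℕ) (g : ℕ → M) (n : ℕ) :
    ∑ k ∈ Finset.range n, (if r ∣ k + 1 then g (k + 1) else 0) =
      ∑ i ∈ Finset.range (n / r), g (r * (i + 1)) := by
  induction n with
  | zero => simp
  | succ n ih =>
    rw [Finset.sum_range_succ, ih, Nat.succ_div]
    split_ifs with h
    · rw [Finset.sum_range_succ]
      congr 2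
      have h' := Nat.div_mul_cancel h
      rw [Nat.succ_div, if_pos h] at h'
      rw [mul_comm, h']
    · simp

/-! ### The embedding of `F[t]` in `K_∞`. -/

section Embedding

variable {F : Type*} [Field F] [DecidableEq (RatFunc F)]

theorem polyToKInfty_add (x y : F[X]) :
    polyToKInfty F (x + y) = polyToKInfty F x + polyToKInfty F y := by
  simp [polyToKInfty]

theorem polyToKInfty_mul (x y : F[X]) :
    polyToKInfty F (x * y) = polyToKInfty F x * polyToKInfty F y := by
  simp [polyToKInfty]

theorem polyToKInfty_ne_zero {x : F[X]} (hx : x ≠ 0) : polyToKInfty F x ≠ 0 := by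
  intro h
  have := valued_polyToKInfty F x hx
  rw [h, map_zero] at this
  exact WithZero.exp_ne_zero this.symm

instance instT2SpaceCompletionAtInfty : T2Space (RatFunc.CompletionAtInfty F) := by
  let : UniformSpace (RatFunc F) := (RatFunc.inftyValued F).toUniformSpace
  exact inferInstanceAs (T2Space (UniformSpace.Completion (RatFunc F)))

instance instCharPCompletionAtInfty (p : ℕ) [CharP F p] :
    CharP (RatFunc.CompletionAtInfty F) p := by
  have : CharP (RatFunc F) p := charP_of_injective_algebraMap (algebraMap F (RatFunc F)).injective p
  exact charP_of_injective_algebraMap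
    (algebraMap (RatFunc F) (RatFunc.CompletionAtInfty F)).injective p

end Embedding

/-! ### Classification of pairs of monic polynomials. -/

section Tuples

variable (F : Type*) [Field F]

/-- A decreasing tuple of length one is a monic polynomial. -/
def decreasingMonicTupleOneEquiv : DecreasingMonicTuple F 1 ≃ {a : F[X] // a.Monic} where
  toFun a := ⟨a.1 0, a.2.1 0⟩
  invFun a := ⟨![a.1], by simpa using a.2, Subsingleton.strictAnti _⟩
  left_inv a := by
    apply Subtype.ext
    funext i
    fin_cases i
    rfl
  right_inv a := rfl

variable {F}

theorem DecreasingMonicTuple.natDegree_lt (a : DecreasingMonicTuple F 2) :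
    (a.1 1).natDegree < (a.1 0).natDegree := a.2.2 (by decide)

/-- The decreasing pair `(x, y)`. -/
def DecreasingMonicTuple.pair (x y : F[X]) (hx : x.Monic) (hy : y.Monic)
    (h : y.natDegree < x.natDegree) : DecreasingMonicTuple F 2 :=
  ⟨![x, y], by simp [Fin.forall_fin_two, hx, hy], by
    intro i j hij
    fin_cases i <;> fin_cases j <;> simp_all⟩

theorem DecreasingMonicTuple.ext_two {a b : DecreasingMonicTuple F 2} (h0 : a.1 0 = b.1 0)
    (h1 : a.1 1 = b.1 1) : a = b := by
  apply Subtype.ext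
  funext i
  fin_cases i <;> assumption

theorem DecreasingMonicTuple.degree_C_mul_lt (a : DecreasingMonicTuple F 2) (f : Fˣ) :
    (C (f : F) * a.1 1).degree < (a.1 0).degree := by
  rw [degree_C_mul f.ne_zero]
  exact degree_lt_degree a.natDegree_lt

theorem DecreasingMonicTuple.monic_add (a : DecreasingMonicTuple F 2) (f : Fˣ) :
    (a.1 0 + C (f : F) * a.1 1).Monic :=
  (a.2.1 0).add_of_left (a.degree_C_mul_lt f)

theorem DecreasingMonicTuple.natDegree_add (a : DecreasingMonicTuple F 2) (f : Fˣ) :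
    (a.1 0 + C (f : F) * a.1 1).natDegree = (a.1 0).natDegree :=
  natDegree_add_eq_left_of_degree_lt (a.degree_C_mul_lt f)

/-- The map `(y, c, f) ↦ (y + f c, c, f)`. -/
noncomputable def DecreasingMonicTuple.shift (p : DecreasingMonicTuple F 2 × Fˣ) :
    DecreasingMonicTuple F 2 × Fˣ :=
  (.pair (p.1.1 0 + C (p.2 : F) * p.1.1 1) (p.1.1 1) (p.1.monic_add _) (p.1.2.1 1)
    (by rw [p.1.natDegree_add]; exact p.1.natDegree_lt), p.2)

theorem DecreasingMonicTuple.shift_involutive [CharP F 2] :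
    Function.Involutive (shift : DecreasingMonicTuple F 2 × Fˣ → _) := by
  rintro ⟨a, f⟩
  refine Prod.ext (ext_two ?_ rfl) rfl
  change a.1 0 + C (f : F) * a.1 1 + C (f : F) * a.1 1 = a.1 0
  rw [add_assoc, CharTwo.add_self_eq_zero, add_zero]

/-- Pairs `(x, y)` of monic polynomials are classified into pairs with `deg x > deg y`, pairs with
`deg x < deg y`, pairs with `x = y`, and pairs with `x = y + f c` for a unit `f` and a monic `c`
of degree less than that of `y`. -/
noncomputable def monicPairOfSum :
    DecreasingMonicTuple F 2 ⊕ DecreasingMonicTuple F 2 ⊕ DecreasingMonicTuple F 1 ⊕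
      DecreasingMonicTuple F 2 × Fˣ → DecreasingMonicTuple F 1 × DecreasingMonicTuple F 1 :=
  fun u => Prod.map (decreasingMonicTupleOneEquiv F).symm (decreasingMonicTupleOneEquiv F).symm <|
    match u with
    | .inl a => (⟨a.1 0, a.2.1 0⟩, ⟨a.1 1, a.2.1 1⟩)
    | .inr (.inl a) => (⟨a.1 1, a.2.1 1⟩, ⟨a.1 0, a.2.1 0⟩)
    | .inr (.inr (.inl a)) => (⟨a.1 0, a.2.1 0⟩, ⟨a.1 0, a.2.1 0⟩)
    | .inr (.inr (.inr p)) =>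
      (⟨p.1.1 0 + C (p.2 : F) * p.1.1 1, p.1.monic_add p.2⟩, ⟨p.1.1 0, p.1.2.1 0⟩)

theorem monicPairOfSum_injective : Function.Injective (monicPairOfSum (F := F)) := by
  refine (((decreasingMonicTupleOneEquiv F).symm.injective).prodMap
    ((decreasingMonicTupleOneEquiv F).symm.injective)).comp ?_
  rintro (a | a | a | ⟨a, f⟩) (b | b | b | ⟨b, g⟩) h <;>
    simp only [Prod.mk.injEq, Subtype.mk.injEq] at h <;> obtain ⟨h0, h1⟩ := h
  · rw [DecreasingMonicTuple.ext_two h0 h1]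
  · have := a.natDegree_lt
    have := b.natDegree_lt
    rw [h0, h1] at *
    omega
  · have := a.natDegree_lt
    rw [h0, h1] at this
    omega
  · have := a.natDegree_lt
    rw [h0, h1, b.natDegree_add] at this
    omega
  · have := a.natDegree_lt
    have := b.natDegree_lt
    rw [h0, h1] at *
    omega
  · rw [DecreasingMonicTuple.ext_two h1 h0]
  · have := a.natDegree_lt
    rw [h0, h1] at this
    omega
  · have := a.natDegree_lt
    rw [h0, h1, b.natDegree_add] at this
    omega
  · have := b.natDegree_lt
    rw [← h0, ← h1] at this
    omega
  · have := b.natDegree_lt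
    rw [← h0, ← h1] at this
    omega
  · rw [show a = b from Subtype.ext (funext fun i => by fin_cases i; exact h0)]
  · rw [← h1, eq_comm, add_eq_left] at h0
    exact absurd h0 (mul_ne_zero (C_ne_zero.2 g.ne_zero) (b.2.1 1).ne_zero)
  · have := b.natDegree_lt
    rw [← h0, ← h1, a.natDegree_add] at this
    omega
  · have := b.natDegree_lt
    rw [← h0, ← h1, a.natDegree_add] at this
    omega
  · rw [← h1, add_eq_left] at h0
    exact absurd h0 (mul_ne_zero (C_ne_zero.2 f.ne_zero) (a.2.1 1).ne_zero)
  -- Since `c` is monic, `f` is the leading coefficient of `f c`.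
  · rw [h1, add_right_inj] at h0
    have hfg := congrArg leadingCoeff h0
    simp only [leadingCoeff_mul, leadingCoeff_C, (a.2.1 1).leadingCoeff,
      (b.2.1 1).leadingCoeff, mul_one] at hfg
    rw [hfg] at h0
    have h2 := mul_left_cancel₀ (C_ne_zero.2 g.ne_zero) h0
    rw [DecreasingMonicTuple.ext_two h1 h2, Units.ext hfg]

theorem monicPairOfSum_surjective : Function.Surjective (monicPairOfSum (F := F)) := by
  refine (((decreasingMonicTupleOneEquiv F).symm.surjective).prodMap
    ((decreasingMonicTupleOneEquiv F).symm.surjective)).comp ?_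
  rintro ⟨⟨x, hx⟩, ⟨y, hy⟩⟩
  rcases lt_trichotomy y.natDegree x.natDegree with h | h | h
  · exact ⟨.inl (.pair x y hx hy h), rfl⟩
  · by_cases hxy : x = y
    · subst hxy
      exact ⟨.inr (.inr (.inl ((decreasingMonicTupleOneEquiv F).symm ⟨x, hx⟩))), rfl⟩
    · have hz : x - y ≠ 0 := sub_ne_zero.2 hxy
      have hl : (x - y).leadingCoeff ≠ 0 := leadingCoeff_ne_zero.2 hz
      have hd : (x - y).degree < y.degree := by
        have hdeg : x.degree = y.degree := by
          rw [degree_eq_natDegree hx.ne_zero, degree_eq_natDegree hy.ne_zero, h]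
        rw [← hdeg]
        exact degree_sub_lt_left hdeg hx.ne_zero (by rw [hx.leadingCoeff, hy.leadingCoeff])
      -- Take `f` to be the leading coefficient of `x - y` and `c = (x - y) / f`.
      refine ⟨.inr (.inr (.inr (.pair y ((x - y) * C (x - y).leadingCoeff⁻¹) hy
        (monic_mul_leadingCoeff_inv hz) ?_, Units.mk0 _ hl))), ?_⟩
      · rw [natDegree_mul_C (inv_ne_zero hl)]
        exact natDegree_lt_natDegree hz hd
      · refine Prod.ext (Subtype.ext ?_) rfl
        change y + C (x - y).leadingCoeff * ((x - y) * C (x - y).leadingCoeff⁻¹) = x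
        rw [mul_left_comm, ← C_mul, mul_inv_cancel₀ hl]
        simp
  · exact ⟨.inr (.inl (.pair y x hy hx h)), rfl⟩

end Tuples

/-! ### Summation over pairs in `K_∞`. -/

section Sums

theorem HasSum.of_eq {α M : Type*} [AddCommMonoid M] [TopologicalSpace M] {f g : α → M} {a b : M}
    (h : HasSum f a) (hf : ∀ x, f x = g x) (ha : a = b) : HasSum g b :=
  ha ▸ (funext hf : f = g) ▸ h

variable {F : Type*} [Field F] [Finite F] [DecidableEq (RatFunc F)]

theorem hasSum_multizeta_one {k : ℕ} (hk : 0 < k) :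
    HasSum (fun a : DecreasingMonicTuple F 1 => (polyToKInfty F (a.1 0) ^ k)⁻¹)
      (multizeta F ![(k : ℤ)]) := by
  refine (summable_multizeta F ![(k : ℤ)] (by simpa using hk)).hasSum.of_eq (fun a => ?_) rfl
  simp

theorem hasSum_multizeta_two {k l : ℕ} (hk : 0 < k) (hl : 0 < l) :
    HasSum (fun a : DecreasingMonicTuple F 2 =>
        (polyToKInfty F (a.1 0) ^ k)⁻¹ * (polyToKInfty F (a.1 1) ^ l)⁻¹)
      (multizeta F ![(k : ℤ), (l : ℤ)]) := by
  refine (summable_multizeta F ![(k : ℤ), (l : ℤ)]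
    (by simp [Fin.forall_fin_two, hk, hl])).hasSum.of_eq (fun a => ?_) rfl
  simp [Fin.prod_univ_two, mul_comm]

variable [CharP F 2]

/-- Power sums over the units of `F`, embedded in `K_∞`. -/
theorem hasSum_units_inv_pow (l : ℕ) :
    HasSum (fun f : Fˣ => (polyToKInfty F (C (f : F)) ^ l)⁻¹)
      (if Nat.card F - 1 ∣ l then 1 else 0) := by
  classical
  have := Fintype.ofFinite F
  let φ : F →+* RatFunc.CompletionAtInfty F :=
    (algebraMap (RatFunc F) (RatFunc.CompletionAtInfty F)).comp
      ((algebraMap F[X] (RatFunc F)).comp C)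
  have h : ∑ f : Fˣ, (polyToKInfty F (C (f : F)) ^ l)⁻¹ =
      (if Nat.card F - 1 ∣ l then 1 else 0) := by
    have h1 : ∀ f : Fˣ, (polyToKInfty F (C (f : F)) ^ l)⁻¹ = φ (((f⁻¹ : Fˣ) : F) ^ l) := by
      intro f
      rw [Units.val_inv_eq_inv_val, inv_pow, map_inv₀, map_pow]
      rfl
    rw [Finset.sum_congr rfl fun f _ => h1 f, ← map_sum,
      show ∑ f : Fˣ, ((f⁻¹ : Fˣ) : F) ^ l = ∑ f : Fˣ, (f : F) ^ l from
        Equiv.sum_comp (Equiv.inv Fˣ) fun f => (f : F) ^ l]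
    have h2 := FiniteField.sum_pow_units F l
    rw [h2, Nat.card_eq_fintype_card, CharTwo.neg_eq]
    split_ifs <;> simp
  rw [← h]
  exact hasSum_fintype _

theorem hasSum_inv_pow_mul_inv_pow {k l : ℕ} (hk : 0 < k) (hl : 0 < l) :
    HasSum (fun p : DecreasingMonicTuple F 2 × Fˣ =>
        (polyToKInfty F (p.1.1 0) ^ k)⁻¹ *
          (polyToKInfty F (C (p.2 : F) * p.1.1 1) ^ l)⁻¹)
      (if Nat.card F - 1 ∣ l then multizeta F ![(k : ℤ), (l : ℤ)] else 0) := by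
  refine ((hasSum_multizeta_two (F := F) hk hl).mul_of_nonarchimedean
    (hasSum_units_inv_pow (F := F) l)).of_eq (fun p => ?_) ?_
  · rw [polyToKInfty_mul, mul_pow, mul_inv]
    ring
  · split_ifs <;> simp

/-- The involution `shift` swaps `y` and `x = y + f c` while fixing `f c`, so terms in `1 / x` sum
like terms in `1 / y`. -/
theorem hasSum_shift_inv_pow_mul_inv_pow {k l : ℕ} (hk : 0 < k) (hl : 0 < l) :
    HasSum (fun p : DecreasingMonicTuple F 2 × Fˣ =>
        (polyToKInfty F (p.1.1 0 + C (p.2 : F) * p.1.1 1) ^ k)⁻¹ *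
          (polyToKInfty F (C (p.2 : F) * p.1.1 1) ^ l)⁻¹)
      (if Nat.card F - 1 ∣ l then multizeta F ![(k : ℤ), (l : ℤ)] else 0) :=
  ((DecreasingMonicTuple.shift_involutive.toPerm.hasSum_iff).2
    (hasSum_inv_pow_mul_inv_pow (F := F) hk hl)).of_eq (fun _ => rfl) rfl

/-- The sum of `1 / (x ^ 2 * y ^ b)` over the pairs of distinct monic polynomials of the same
degree. -/
theorem hasSum_sameDegree (b : ℕ) :
    HasSum (fun p : DecreasingMonicTuple F 2 × Fˣ =>
        (polyToKInfty F (p.1.1 0 + C (p.2 : F) * p.1.1 1) ^ 2)⁻¹ *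
          (polyToKInfty F (p.1.1 0) ^ (b + 1))⁻¹)
      (∑ k ∈ Finset.range (b + 1), ((k + 1 : ℕ) : RatFunc.CompletionAtInfty F) *
          (if Nat.card F - 1 ∣ k + 2 then
            multizeta F ![((b + 1 - k : ℕ) : ℤ), ((k + 2 : ℕ) : ℤ)] else 0)
        + (if Nat.card F - 1 ∣ b + 1 then
            multizeta F ![((2 : ℕ) : ℤ), ((b + 1 : ℕ) : ℤ)] else 0)
        + ((b + 1 : ℕ) : RatFunc.CompletionAtInfty F) * (if Nat.card F - 1 ∣ b + 2 then
            multizeta F ![((1 : ℕ) : ℤ), ((b + 2 : ℕ) : ℤ)] else 0)) := by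
  refine (((hasSum_sum (s := Finset.range (b + 1)) fun k hk => (hasSum_inv_pow_mul_inv_pow (F := F) (k := b + 1 - k)
    (l := k + 2) (by have := Finset.mem_range.1 hk; omega) (by omega)).mul_left
      ((k + 1 : ℕ) : RatFunc.CompletionAtInfty F)).add
    (hasSum_shift_inv_pow_mul_inv_pow (F := F) (k := 2) (l := b + 1) (by omega) (by omega))).add
    ((hasSum_shift_inv_pow_mul_inv_pow (F := F) (k := 1) (l := b + 2) (by omega)
      (by omega)).mul_left ((b + 1 : ℕ) : RatFunc.CompletionAtInfty F))).of_eq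
      (fun p => ?_) rfl
  have hz : C (p.2 : F) * p.1.1 1 ≠ 0 :=
    mul_ne_zero (C_ne_zero.2 p.2.ne_zero) (p.1.2.1 1).ne_zero
  have hsum : polyToKInfty F (p.1.1 0 + C (p.2 : F) * p.1.1 1) + polyToKInfty F (p.1.1 0) =
      polyToKInfty F (C (p.2 : F) * p.1.1 1) := by
    rw [polyToKInfty_add, add_right_comm, CharTwo.add_self_eq_zero, zero_add]
  have key := inv_sq_mul_inv_pow_eq_sum (polyToKInfty_ne_zero (p.1.monic_add p.2).ne_zero)
    (polyToKInfty_ne_zero (p.1.2.1 0).ne_zero)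
    (by rw [hsum]; exact polyToKInfty_ne_zero hz) b
  rw [hsum] at key
  exact key.symm

/-- Chen's formula for `ζ(2) ζ(b + 1)` in characteristic two. -/
theorem multizeta_two_mul_multizeta (b : ℕ) :
    multizeta F ![((2 : ℕ) : ℤ)] * multizeta F ![((b + 1 : ℕ) : ℤ)] =
      multizeta F ![((2 : ℕ) : ℤ), ((b + 1 : ℕ) : ℤ)] +
      (multizeta F ![((b + 1 : ℕ) : ℤ), ((2 : ℕ) : ℤ)] +
      (multizeta F ![((2 + (b + 1) : ℕ) : ℤ)] +
      (∑ k ∈ Finset.range (b + 1), ((k + 1 : ℕ) : RatFunc.CompletionAtInfty F) *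
          (if Nat.card F - 1 ∣ k + 2 then
            multizeta F ![((b + 1 - k : ℕ) : ℤ), ((k + 2 : ℕ) : ℤ)] else 0)
        + (if Nat.card F - 1 ∣ b + 1 then
            multizeta F ![((2 : ℕ) : ℤ), ((b + 1 : ℕ) : ℤ)] else 0)
        + ((b + 1 : ℕ) : RatFunc.CompletionAtInfty F) * (if Nat.card F - 1 ∣ b + 2 then
            multizeta F ![((1 : ℕ) : ℤ), ((b + 2 : ℕ) : ℤ)] else 0)))) := by
  have h1 := (hasSum_multizeta_one (F := F) (k := 2) (by omega)).mul_of_nonarchimedean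
    (hasSum_multizeta_one (F := F) (k := b + 1) (by omega))
  have h2 := ((Equiv.ofBijective _
    ⟨monicPairOfSum_injective (F := F), monicPairOfSum_surjective⟩).hasSum_iff).2 h1
  refine h2.unique (HasSum.sum ?_ (HasSum.sum ?_ (HasSum.sum ?_ ?_)))
  · exact hasSum_multizeta_two (by omega) (by omega)
  · exact (hasSum_multizeta_two (F := F) (k := b + 1) (l := 2) (by omega) (by omega)).of_eq
      (fun _ => mul_comm _ _) rfl
  · refine (hasSum_multizeta_one (F := F) (k := 2 + (b + 1)) (by omega)).of_eq (fun a => ?_) rfl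
    rw [pow_add, mul_inv]
    rfl
  · exact hasSum_sameDegree b

end Sums

/-! ### Coefficients modulo 2 and boundary terms. -/

section CharTwo

theorem CharTwo.natCast_of_even {R : Type*} [Ring R] [CharP R 2] {n : ℕ} (h : Even n) :
    (n : R) = 0 :=
  (CharP.cast_eq_zero_iff R 2 n).2 h.two_dvd

theorem CharTwo.natCast_of_odd {R : Type*} [Ring R] [CharP R 2] {n : ℕ} (h : Odd n) :
    (n : R) = 1 := by
  obtain ⟨k, rfl⟩ := h
  rw [Nat.cast_add, CharTwo.natCast_of_even (even_two_mul k), zero_add, Nat.cast_one]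

/-- In characteristic two the coefficients `k + 1` restrict a sum over multiples of an odd `d` to
the multiples of `2 * d`. -/
theorem sum_range_mul_ite_dvd {R : Type*} [Ring R] [CharP R 2] {d : ℕ} (hd : Odd d) (g : ℕ → R)
    (n : ℕ) :
    ∑ k ∈ Finset.range n, ((k + 1 : ℕ) : R) * (if d ∣ k + 2 then g (k + 2) else 0) =
      ∑ i ∈ Finset.range ((n + 1) / (2 * d)), g (2 * d * (i + 1)) := by
  -- The index is offset by one; the extra initial term vanishes since `2 * d` does not divide 1.
  rw [← sum_range_ite_dvd, Finset.sum_range_succ', if_neg, add_zero]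
  · refine Finset.sum_congr rfl fun k _ => ?_
    have hdvd : 2 * d ∣ k + 1 + 1 ↔ Even k ∧ d ∣ k + 2 := by
      refine ⟨fun h => ⟨?_, (dvd_mul_left d 2).trans h⟩, fun h =>
        (Nat.coprime_two_left.2 hd).mul_dvd_of_dvd_of_dvd (h.1.add even_two).two_dvd h.2⟩
      have := (dvd_mul_right 2 d).trans h
      grind
    rw [if_congr hdvd rfl rfl]
    rcases Nat.even_or_odd k with hk | hk
    · rw [CharTwo.natCast_of_odd hk.add_one, one_mul]
      simp [hk]
    · rw [CharTwo.natCast_of_even hk.add_one, zero_mul, if_neg]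
      exact fun h => Nat.not_even_iff_odd.2 hk h.1
  · intro h
    have := Nat.dvd_one.1 h
    omega

/-- Combining the boundary terms of the product formula. -/
theorem sum_add_boundary_eq {R : Type*} [Ring R] [CharP R 2] {d n σ β : ℕ} (hd : Odd d)
    (hb : n + 1 = 2 * d * σ + β) (hβ : 0 < β) (hβ' : β ≤ 2 * d) (g : ℕ → R) :
    ∑ k ∈ Finset.range (n + 1), ((k + 1 : ℕ) : R) * (if d ∣ k + 2 then g (k + 2) else 0)
        + (if d ∣ n + 1 then g (n + 1) else 0)
        + ((n + 1 : ℕ) : R) * (if d ∣ n + 2 then g (n + 2) else 0) =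
      ∑ i ∈ Finset.range σ, g (2 * d * (i + 1))
        + (if d ∣ n + 1 then (((n + 1) / d : ℕ) : R) else 0) * g (n + 1) := by
  rw [sum_range_mul_ite_dvd hd]
  have hd0 : 0 < d := hd.pos
  have hodd : ¬ 2 * d ∣ n + 1 → (if d ∣ n + 1 then (((n + 1) / d : ℕ) : R) else 0) * g (n + 1) =
      if d ∣ n + 1 then g (n + 1) else 0 := by
    intro h
    split_ifs with h1
    · rw [CharTwo.natCast_of_odd, one_mul]
      rw [← Nat.not_even_iff_odd, even_iff_two_dvd, Nat.dvd_div_iff_mul_dvd h1, mul_comm]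
      exact h
    · rw [zero_mul]
  have hndvd : ∀ m c, m = 2 * d * σ + c → 0 < c → c < 2 * d → ¬ 2 * d ∣ m := by
    rintro m c rfl h0 h1 h
    exact Nat.not_dvd_of_pos_of_lt h0 h1 ((Nat.dvd_add_right (dvd_mul_right _ _)).1 h)
  rcases lt_trichotomy (β + 1) (2 * d) with h | h | h
  -- Generic case: the last term vanishes, because `n + 1` odd and `d ∣ n + 2` would force `2 * d ∣
  -- n + 2`.
  · rw [show (n + 1 + 1) / (2 * d) = σ from by
      rw [hb, add_assoc, Nat.mul_add_div (by omega), Nat.div_eq_of_lt h, add_zero],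
      hodd (hndvd _ _ hb hβ (by omega)), add_assoc]
    congr 1
    rw [add_eq_left]
    rcases Nat.even_or_odd (n + 1) with he | ho
    · rw [CharTwo.natCast_of_even he, zero_mul]
    · rw [if_neg, mul_zero]
      intro h2
      refine hndvd (n + 2) (β + 1) (by omega) (by omega) h ?_
      exact (Nat.coprime_two_left.2 hd).mul_dvd_of_dvd_of_dvd ho.add_one.two_dvd h2
  -- The sum has an extra term `g (n + 2)`, which cancels the last boundary term.
  · have hn : n + 2 = 2 * d * (σ + 1) := by rw [mul_add, mul_one]; omega
    rw [show (n + 1 + 1) / (2 * d) = σ + 1 from by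
      rw [hn]; exact Nat.mul_div_cancel_left _ (by omega),
      hodd (hndvd _ _ hb hβ (by omega)), Finset.sum_range_succ, ← hn,
      if_pos (c := d ∣ n + 2) ⟨2 * (σ + 1), by rw [hn]; ring⟩,
      CharTwo.natCast_of_odd, one_mul, add_right_comm, add_assoc (∑ i ∈ _, _), CharTwo.add_self_eq_zero, add_zero]
    have : Even (n + 2) := by rw [hn, mul_assoc]; exact even_two_mul _
    grind
  -- The extra term is now `g (n + 1)`; it cancels the first boundary term, and `(n + 1) / d` is
  -- even.
  · have hn : n + 1 = 2 * d * (σ + 1) := by rw [mul_add, mul_one]; omega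
    have he : Even (n + 1) := by rw [hn, mul_assoc]; exact even_two_mul _
    have hdvd : d ∣ n + 1 := ⟨2 * (σ + 1), by rw [hn]; ring⟩
    have hlt : 1 < 2 * d := by omega
    rw [show (n + 1 + 1) / (2 * d) = σ + 1 from by
      rw [hn, Nat.mul_add_div (by omega), Nat.div_eq_of_lt hlt, add_zero],
      Finset.sum_range_succ, ← hn, if_pos hdvd, if_pos hdvd, CharTwo.natCast_of_even he, zero_mul,
      add_zero, add_assoc, CharTwo.add_self_eq_zero, CharTwo.natCast_of_even, zero_mul]
    rw [even_iff_two_dvd, Nat.dvd_div_iff_mul_dvd hdvd, hn, mul_comm d]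
    exact dvd_mul_right _ _

end CharTwo

theorem theorem7p6 (s q : ℕ) (hq : q = 2 ^ s) (F : Type*) [Field F] [Finite F]
    [DecidableEq (RatFunc F)] (hF : Nat.card F = q) (b σ β : ℕ)
    (hb : b = rParam 2 q 2 * σ + β) (hβ : 0 < β) (hβ' : β ≤ rParam 2 q 2) :
    multizeta F ![2] * multizeta F ![(b : ℤ)] =
      multizeta F ![2 + (b : ℤ)] + multizeta F ![2, (b : ℤ)] + multizeta F ![(b : ℤ), 2]
      + ∑ i ∈ Finset.range σ,
          multizeta F ![(b : ℤ) - phiParam 2 q 2 i 0, 2 + phiParam 2 q 2 i 0]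
      + (if q - 1 ∣ b then ((b / (q - 1) : ℕ) : RatFunc.CompletionAtInfty F) else 0)
          * multizeta F ![2, (b : ℤ)] := by
  have hq1 : 1 < q := hF ▸ Finite.one_lt_card
  have hs : s ≠ 0 := by
    rintro rfl
    omega
  have hchar : CharP F 2 := by
    obtain ⟨p, hp⟩ := CharP.exists F
    have hprime : p.Prime := CharP.char_is_prime F p
    have := Fintype.ofFinite F
    obtain ⟨k, -, hk⟩ := FiniteField.card F p
    rw [← Nat.card_eq_fintype_card, hF, hq] at hk
    have h2 : 2 ∣ p ^ (k : ℕ) := hk ▸ dvd_pow_self 2 hs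
    rwa [(Nat.prime_dvd_prime_iff_eq Nat.prime_two hprime).1
      (Nat.prime_two.dvd_of_dvd_pow h2)]
  have hd : Odd (q - 1) := by
    have : Even q := hq ▸ (even_two.pow_of_ne_zero hs)
    grind
  have hr : rParam 2 q 2 = 2 * (q - 1) := by
    rw [rParam, Nat.clog_eq_one le_rfl le_rfl, pow_one, mul_comm]
  rw [hr] at hb hβ'
  obtain ⟨n, rfl⟩ : ∃ n, b = n + 1 := ⟨b - 1, by omega⟩
  -- All the depth-two values have weight `b + 2 = n + 3`, so the second argument determines them.
  let g : ℕ → RatFunc.CompletionAtInfty F := fun j => multizeta F ![(n + 3 : ℤ) - j, (j : ℤ)]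
  have key := sum_add_boundary_eq hd hb hβ hβ' g
  have hg1 : g (n + 1) = multizeta F ![2, ((n + 1 : ℕ) : ℤ)] := by
    simp only [g]
    congr 3
    push_cast
    ring
  have hg2 : g (n + 2) = multizeta F ![1, ((n + 2 : ℕ) : ℤ)] := by
    simp only [g]
    congr 3
    push_cast
    ring
  have hsum : ∀ i ∈ Finset.range σ, multizeta F ![((n + 1 : ℕ) : ℤ) - phiParam 2 q 2 i 0,
      2 + phiParam 2 q 2 i 0] = g (2 * (q - 1) * (i + 1)) := by
    intro i _
    have hφ : phiParam 2 q 2 i 0 = ((2 * (q - 1) * (i + 1) : ℕ) : ℤ) - 2 := by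
      rw [phiParam, hr]
      push_cast
      ring
    simp only [g]
    rw [hφ, add_sub_cancel]
    congr 2
    push_cast
    ring
  have hterm : ∀ k ∈ Finset.range (n + 1), ((k + 1 : ℕ) : RatFunc.CompletionAtInfty F) *
      (if q - 1 ∣ k + 2 then multizeta F ![((n + 1 - k : ℕ) : ℤ), ((k + 2 : ℕ) : ℤ)] else 0) =
      ((k + 1 : ℕ) : RatFunc.CompletionAtInfty F) *
        (if q - 1 ∣ k + 2 then g (k + 2) else 0) := by
    intro k hk
    have hk' := Finset.mem_range.1 hk
    simp only [g]
    rw [show ((n + 1 - k : ℕ) : ℤ) = (n + 3 : ℤ) - (k + 2 : ℕ) by push_cast; omega]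
  have main := multizeta_two_mul_multizeta (F := F) n
  rw [hF, Finset.sum_congr rfl hterm] at main
  rw [hg1, hg2] at key
  rw [Finset.sum_congr rfl hsum]
  push_cast at main key ⊢
  rw [main, key]
  ring
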